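/- Let $\mathcal C^{(d)}$ be the space of nonempty compact subsets (particles) of $\mathbb R^d$ with the Hausdorff metric and its Borel $\sigma$-field, and let $z(K)$ be the centre of the smallest closed ball containing $K$. Let $\mathbf N$ be the set of measures $\xi$ on $\mathcal C^{(d)}$ with values in $\mathbb N_0\cup\{\infty\}$ that are finite on every closed ball, with the $\sigma$-field generated by the maps $\xi\mapsto\xi(A)$, $A\subseteq\mathcal C^{(d)}$ Borel; $\xi_A$ is the restriction of $\xi$ to $A$. Let $\nu$ be a probability measure on $\mathcal C^{(d)}$ with $z(K)=0$ and $K\subseteq B(0,R)$ for $\nu$-a.e. $K$, for some $R>0$, and put $\mu:=\iint\mathbf 1\{K+x\in\cdot\}\,\nu(\mathrm dK)\,\mathrm dx$. Fix $\lambda>0$. For a measurable $\kappa\colon\mathcal C^{(d)}\times\mathbf N\to[0,\infty)$, a probability measure $P$ on $\mathbf N$ is called a Gibbs distribution with Papangelou intensity $\kappa$ and activity $\lambda$ if $$\iint f(K,\xi-\delta_K)\,\xi(\mathrm dK)\,P(\mathrm d\xi)=\lambda\iint f(K,\xi)\,\kappa(K,\xi)\,\mu(\mathrm dK)\,P(\mathrm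 d\xi)$$ for all measurable $f\ge 0$. For $p\in\mathbb N$ let $\xi^{(p)}$ be the restriction of the product measure $\xi^p$ to $p$-tuples with pairwise distinct entries. The $p$-th factorial moment measure of $P$ is $\alpha_P^{(p)}:=\int\xi^{(p)}(\cdot)\,P(\mathrm d\xi)$. A family of $p$-th Palm distributions of $P$ is a probability kernel $(K_1,\dots,K_p)\mapsto P_{K_1,\dots,K_p}$ from $(\mathcal C^{(d)})^p$ to $\mathbf N$ with $$\iint f(K_1,\dots,K_p,\xi)\,\xi^{(p)}(\mathrm d(K_1,\dots,K_p))\,P(\mathrm d\xi)=\iint f(K_1,\dots,K_p,\xi)\,P_{K_1,\dots,K_p}(\mathrm d\xi)\,\alpha_P^{(p)}(\mathrm d(K_1,\dots,K_p))$$ for all measurable $f\ge0$. The reduced Palm distribution $P^!_{K_1,\dots,K_p}$ is the image of $P_{K_1,\dots,K_p}$ under $\xi\mapsto\xi-\delta_{K_1}-\dots-\delta_{K_p}$. **Lemma.** Let $\Xi$ be a particle process (a random element of $\mathbf N$) which is almost surely simple, that is, $\Xi(z^{-1}(\{x\}))\in\{0,1\}$ for all $x\in\mathbb R^d$, and whose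 distribution is a Gibbs distribution with Papangelou intensity $\kappa$ and activity $\lambda$. Let $p\in\mathbb N$, let $\Psi=z^{-1}(B)$ with $B\subseteq\mathbb R^d$ bounded and Borel, and let $P_{\Psi,\chi}=\mathbb P(\Xi_\Psi\in\cdot\mid\Xi_{\Psi^c}=\chi)$ be any version of the regular conditional distribution of $\Xi_\Psi$ given $\Xi_{\Psi^c}$. Then for $\mathbb P(\Xi_{\Psi^c}\in\cdot)$-a.e. boundary condition $\chi$, for every family of $p$-th Palm distributions of $P_{\Psi,\chi}$, and for $\alpha^{(p)}_{P_{\Psi,\chi}}$-a.e. $(K_1,\dots,K_p)$, the reduced Palm distribution $P^{!}_{\Psi,\chi,K_1,\dots,K_p}$ is a Gibbs distribution with activity $\lambda$, and a version of its Papangelou intensity is $$(K,\xi)\mapsto\mathbf 1\{K\in\Psi\}\,\kappa(K,\xi+\chi+\delta_{K_1}+\dots+\delta_{K_p}).$$ -/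

import Mathlib

open MeasureTheory ProbabilityTheory TopologicalSpace Metric
open scoped ENNReal NNReal

namespace ParticleGibbs

/-- Euclidean space of dimension `d`. -/
abbrev Space (d : ℕ) : Type := EuclideanSpace ℝ (Fin d)

/-- Particles: nonempty compact subsets of `ℝ^d`. Mathlib's metric on this type is the
Hausdorff metric. -/
abbrev Particle (d : ℕ) : Type := NonemptyCompacts (Space d)

/-- The Borel `σ`-field of the Hausdorff metric. -/
instance instMeasurableSpaceParticle (d : ℕ) : MeasurableSpace (Particle d) := borel _

instance instBorelSpaceParticle (d : ℕ) : BorelSpace (Particle d) := ⟨rfl⟩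

/-! ### Circumscribed ball -/

/-- `c` is the centre of a smallest closed ball containing `K`. -/
def IsCircumcenter {d : ℕ} (K : Particle d) (c : Space d) : Prop :=
  ∃ r : ℝ, (K : Set (Space d)) ⊆ closedBall c r ∧
    ∀ (c' : Space d) (r' : ℝ), (K : Set (Space d)) ⊆ closedBall c' r' → r ≤ r'

theorem subset_closedBall_iff {d : ℕ} (K : Particle d) (c : Space d) (r : ℝ) :
    (K : Set (Space d)) ⊆ closedBall c r ↔ dist K ({c} : Particle d) ≤ r := by
  have hne : hausdorffEDist (K : Set (Space d)) (({c} : Particle d) : Set (Space d)) ≠ ⊤ :=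
    hausdorffEDist_ne_top_of_nonempty_of_bounded K.nonempty
      ({c} : Particle d).nonempty K.isCompact.isBounded ({c} : Particle d).isCompact.isBounded
  rw [NonemptyCompacts.dist_eq]
  constructor
  · intro h
    obtain ⟨y, hy⟩ := K.nonempty
    have hr : 0 ≤ r := dist_nonneg.trans (mem_closedBall.1 (h hy))
    refine hausdorffDist_le_of_mem_dist hr (fun x hx => ⟨c, by simp, h hx⟩) ?_
    intro x hx
    have : x = c := by simpa using hx
    subst this
    exact ⟨y, hy, by rw [dist_comm]; exact h hy⟩
  · intro h x hx
    have h1 := infDist_le_hausdorffDist_of_mem hx hne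
    have h2 : infDist x (({c} : Particle d) : Set (Space d)) = dist x c := by
      simp [infDist_singleton]
    rw [mem_closedBall, ← h2]
    exact h1.trans h

theorem exists_isCircumcenter {d : ℕ} (K : Particle d) : ∃ c, IsCircumcenter K c := by
  obtain ⟨y, hy⟩ := K.nonempty
  have hcont : Continuous fun c : Space d => dist K ({c} : Particle d) :=
    continuous_const.dist NonemptyCompacts.isometry_singleton.continuous
  have htend : Filter.Tendsto (fun c : Space d => dist K ({c} : Particle d))
      (Filter.cocompact (Space d)) Filter.atTop := by
    refine Filter.tendsto_atTop_mono (fun c => ?_) (tendsto_dist_left_cocompact_atTop y)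
    exact (subset_closedBall_iff K c _).2 le_rfl hy
  obtain ⟨c, hc⟩ := hcont.exists_forall_le htend
  exact ⟨c, _, (subset_closedBall_iff K c _).2 le_rfl,
    fun c' r' h' => (hc c').trans ((subset_closedBall_iff K c' r').1 h')⟩

theorem IsCircumcenter.unique {d : ℕ} {K : Particle d} {a b : Space d}
    (ha : IsCircumcenter K a) (hb : IsCircumcenter K b) : a = b := by
  obtain ⟨r, har, hmin⟩ := ha
  obtain ⟨s, hbs, hmin'⟩ := hb
  have hrs : r = s := le_antisymm (hmin _ _ hbs) (hmin' _ _ har)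
  subst hrs
  obtain ⟨y, hy⟩ := K.nonempty
  have hr : 0 ≤ r := dist_nonneg.trans (mem_closedBall.1 (har hy))
  have key : (K : Set (Space d)) ⊆
      closedBall (midpoint ℝ a b) (Real.sqrt (r ^ 2 - (dist a b / 2) ^ 2)) := by
    intro x hx
    have h1 : dist x a ≤ r := har hx
    have h2 : dist x b ≤ r := hbs hx
    have h3 := EuclideanGeometry.dist_sq_add_dist_sq_eq_two_mul_dist_midpoint_sq_add_half_dist_sq
      x a b
    rw [mem_closedBall]
    apply Real.le_sqrt_of_sq_le
    nlinarith [pow_le_pow_left₀ dist_nonneg h1 2, pow_le_pow_left₀ dist_nonneg h2 2]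
  have h := hmin _ _ key
  have hk : 0 ≤ r ^ 2 - (dist a b / 2) ^ 2 := by
    have h1 : dist y a ≤ r := har hy
    have h2 : dist y b ≤ r := hbs hy
    have h3 : dist a b ≤ dist y a + dist y b := dist_triangle_left a b y
    have h4 : dist a b / 2 ≤ r := by linarith
    nlinarith [pow_le_pow_left₀ (by positivity) h4 2]
  have h2 := pow_le_pow_left₀ hr h 2
  rw [Real.sq_sqrt hk] at h2
  have : dist a b = 0 := by
    have : dist a b ^ 2 ≤ 0 := by nlinarith
    exact pow_eq_zero_iff (two_ne_zero) |>.1 (le_antisymm this (sq_nonneg _))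
  exact dist_eq_zero.1 this

/-- The centre `z(K)` of the circumscribed ball of `K`. -/
noncomputable def center {d : ℕ} (K : Particle d) : Space d :=
  Classical.choose (exists_isCircumcenter K)

/-- The translate `K + x`. -/
def translate {d : ℕ} (K : Particle d) (x : Space d) : Particle d :=
  K.map (fun y => y + x) (by fun_prop)

/-- The measure `μ = ∫∫ 1{K + x ∈ ·} ν(dK) dx` on particles; `ν` is the particle distribution. -/
noncomputable def particleMeasure {d : ℕ} (ν : Measure (Particle d)) : Measure (Particle d) :=
  (ν.prod (volume : Measure (Space d))).map (fun q => translate q.1 q.2)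

/-! ### Counting measures on particles -/

/-- The space `𝐍` of measures on particles with values in `ℕ ∪ {∞}` which are finite on all
closed balls of the Hausdorff metric. -/
def Config (d : ℕ) : AddSubmonoid (Measure (Particle d)) where
  carrier := {ξ | (∀ A, MeasurableSet A → ∃ n : ℕ∞, ξ A = (n : ℝ≥0∞)) ∧
    ∀ (K : Particle d) (r : ℝ), ξ (closedBall K r) < ∞}
  zero_mem' := ⟨fun _ _ => ⟨0, by simp⟩, fun _ _ => by simp⟩
  add_mem' := by
    rintro ξ η ⟨h1, h2⟩ ⟨h3, h4⟩
    refine ⟨fun A hA => ?_, fun K r => ?_⟩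
    · obtain ⟨n, hn⟩ := h1 A hA
      obtain ⟨m, hm⟩ := h3 A hA
      exact ⟨n + m, by simp [hn, hm]⟩
    · rw [Measure.add_apply]
      exact ENNReal.add_lt_top.2 ⟨h2 K r, h4 K r⟩

/-- The `σ`-field on `𝐍` generated by the evaluations `ξ ↦ ξ A`, `A` Borel. -/
instance instMeasurableSpaceConfig (d : ℕ) : MeasurableSpace (Config d) :=
  Subtype.instMeasurableSpace

instance instSigmaFiniteConfig {d : ℕ} (ξ : Config d) :
    SigmaFinite (ξ : Measure (Particle d)) := by
  refine ⟨⟨⟨fun n : ℕ => closedBall ({0} : Particle d) n, fun _ => trivial,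
    fun n => ξ.2.2 _ _, iUnion_closedBall_nat _⟩⟩⟩

theorem dirac_mem_config {d : ℕ} (K : Particle d) : Measure.dirac K ∈ Config d := by
  classical
  refine ⟨fun A hA => ?_, fun _ _ => measure_lt_top _ _⟩
  rw [Measure.dirac_apply' K hA]
  by_cases h : K ∈ A
  · exact ⟨1, by simp [h]⟩
  · exact ⟨0, by simp [h]⟩

/-- The Dirac measure `δ_K`. -/
noncomputable def δ {d : ℕ} (K : Particle d) : Config d :=
  ⟨Measure.dirac K, dirac_mem_config K⟩

theorem restrict_mem_config {d : ℕ} (ξ : Config d) (Ψ : Set (Particle d)) :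
    (ξ : Measure (Particle d)).restrict Ψ ∈ Config d := by
  refine ⟨fun A hA => ?_, fun K r => (Measure.restrict_apply_le _ _).trans_lt (ξ.2.2 K r)⟩
  rw [Measure.restrict_apply hA, ← measure_toMeasurable]
  exact ξ.2.1 _ (measurableSet_toMeasurable _ _)

/-- The restriction `ξ_Ψ`. -/
noncomputable def restrict {d : ℕ} (ξ : Config d) (Ψ : Set (Particle d)) : Config d :=
  ⟨(ξ : Measure (Particle d)).restrict Ψ, restrict_mem_config ξ Ψ⟩

theorem sub_mem_config {d : ℕ} {ξ η : Config d}
    (hfin : IsFiniteMeasure (η : Measure (Particle d)))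
    (hle : (η : Measure (Particle d)) ≤ ξ) :
    (ξ : Measure (Particle d)) - (η : Measure (Particle d)) ∈ Config d := by
  refine ⟨fun A hA => ?_, fun K r => ?_⟩
  · obtain ⟨n, hn⟩ := ξ.2.1 A hA
    obtain ⟨m, hm⟩ := η.2.1 A hA
    rw [Measure.sub_apply hA hle, hn, hm]
    exact ⟨n - m, by simp⟩
  · exact (Measure.sub_le _).trans_lt (ξ.2.2 K r)

open Classical in
/-- The difference `ξ - η` for finite `η ≤ ξ`. (Otherwise it is not used, and set to `ξ`.) -/
noncomputable def sub {d : ℕ} (ξ η : Config d) : Config d :=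
  if h : IsFiniteMeasure (η : Measure (Particle d)) ∧ (η : Measure (Particle d)) ≤ ξ then
    ⟨(ξ : Measure (Particle d)) - (η : Measure (Particle d)), sub_mem_config h.1 h.2⟩
  else ξ

/-- The factorial measure `ξ^(p)`: the restriction of the product measure `ξ^p` to the
`p`-tuples with pairwise distinct entries. -/
noncomputable def factorialMeasure {d : ℕ} (p : ℕ) (ξ : Config d) :
    Measure (Fin p → Particle d) :=
  (Measure.pi fun _ : Fin p => (ξ : Measure (Particle d))).restrict {K | Function.Injective K}

/-- The factorial moment measure `α^(p)(A) = ∫ ξ^(p)(A) P(dξ)` of a particle process with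
distribution `P`. -/
noncomputable def factorialMomentMeasure {d : ℕ} (p : ℕ) (P : Measure (Config d)) :
    Measure (Fin p → Particle d) :=
  P.bind (factorialMeasure p)

/-! ### Palm distributions and Gibbs distributions -/

/-- The kernel `(K₁, …, K_p) ↦ R_{K₁,…,K_p}` of probability measures is (a version of) the family
of `p`-th Palm distributions of a particle process with distribution `P`. -/
def IsPalm {d : ℕ} (p : ℕ) (P : Measure (Config d))
    (R : Kernel (Fin p → Particle d) (Config d)) : Prop :=
  IsMarkovKernel R ∧
    ∀ f : (Fin p → Particle d) → Config d → ℝ≥0∞, Measurable (Function.uncurry f) →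
      ∫⁻ ξ, ∫⁻ K, f K ξ ∂(factorialMeasure p ξ) ∂P =
        ∫⁻ K, ∫⁻ ξ, f K ξ ∂(R K) ∂(factorialMomentMeasure p P)

/-- The reduced Palm distribution `R^!_{K₁,…,K_p}`: the image of `R_{K₁,…,K_p}` under
`ξ ↦ ξ - δ_{K₁} - … - δ_{K_p}`. -/
noncomputable def reducedPalm {d p : ℕ} (R : Kernel (Fin p → Particle d) (Config d))
    (K : Fin p → Particle d) : Measure (Config d) :=
  (R K).map (fun ξ => sub ξ (∑ i, δ (K i)))

/-- `P` is the distribution of a Gibbs particle process with Papangelou intensity `κ` and activity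
`lam` with respect to the reference measure `μ`: the GNZ equation holds. -/
structure IsGibbs {d : ℕ} (μ : Measure (Particle d)) (lam : ℝ≥0)
    (κ : Particle d → Config d → ℝ≥0) (P : Measure (Config d)) : Prop where
  isProbabilityMeasure : IsProbabilityMeasure P
  measurable_papangelou : Measurable (Function.uncurry κ)
  gnz : ∀ f : Particle d → Config d → ℝ≥0∞, Measurable (Function.uncurry f) →
    ∫⁻ ξ, ∫⁻ K, f K (sub ξ (δ K)) ∂(ξ : Measure (Particle d)) ∂P =
      lam * ∫⁻ ξ, ∫⁻ K, f K ξ * κ K ξ ∂μ ∂P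

/-- The counting measure `ξ` has at most one particle with any given centre. -/
def IsSimple {d : ℕ} (ξ : Config d) : Prop :=
  ∀ x : Space d, (ξ : Measure (Particle d)) (center ⁻¹' {x}) ≤ 1

/-- The Papangelou intensity `(K, ξ) ↦ 1{K ∈ Ψ} κ(K, ξ + χ + δ_{K₁} + … + δ_{K_p})`. -/
noncomputable def palmPapangelou {d p : ℕ} (κ : Particle d → Config d → ℝ≥0)
    (Ψ : Set (Particle d)) (χ : Config d) (K : Fin p → Particle d) :
    Particle d → Config d → ℝ≥0 :=
  fun L ξ => Ψ.indicator (fun L => κ L (ξ + χ + ∑ i, δ (K i))) L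

end ParticleGibbs

/-!
The proof has two independent steps, both carried out with the GNZ equation alone.

*Boundary conditions* (`IsGibbs.ae_condKernel`). For a particle `L ∈ Ψ` of `ξ`, removing `L` from
`ξ` removes it from `ξ_Ψ` and leaves `ξ_{Ψᶜ}` unchanged. Inserting test functions of the form
`1{L ∈ Ψ} F(ξ_{Ψᶜ}, L, ξ_Ψ)` in the GNZ equation of `Ξ` and disintegrating gives the GNZ equation
of `P_{Ψ,χ}` with Papangelou intensity `1{L ∈ Ψ} κ(L, ξ + χ)`, integrated over `χ`.

*Palm distributions* (`IsGibbs.ae_reducedPalm`). Choosing `p` distinct points `K₁, …, K_p` of `ξ`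
and then a further point `L` amounts to choosing `L` first and then `p` distinct points of
`ξ - δ_L` (`HasNoMultiplePoints.lintegral_factorialMeasure_sub`). Hence the GNZ equation for the
test function `(L, η) ↦ ∫ F(K, L, η - δ_{K₁} - … - δ_{K_p}) η^(p)(dK)` is, by the defining property
of Palm distributions, the GNZ equation of the reduced Palm distributions, integrated over `K` with
respect to the factorial moment measure.

In both cases the integrated equation has to be turned into an equation for almost every parameter,
valid for all test functions at once (`ae_isGibbs_of_lintegral`). This works because the space of
configurations is countably generated (`instCountablyGeneratedConfig`), because reduced Campbell
measures are finite on each of countably many sets that cover the space, and because the measure on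
the parameters is `σ`-finite. For factorial moment measures the last point follows from the
existence of Palm distributions (`IsPalm.sigmaFinite`).

At an atom `K` of mass one, subtracting `δ_K` is restricting to the complement of `{K}`. This covers
almost all points of the configurations in question, because locally finite integer-valued measures
are purely atomic (`ae_singleton_ne_zero`) and simplicity bounds the mass of the atoms by one.
Borel measurability of `Ψ` follows from the continuity of the circumcentre (`continuous_center`).
-/

namespace ParticleGibbs

variable {d p : ℕ}

/-! ### Generalities on measurable spaces and kernels -/

theorem exists_countable_isPiSystem_generateFrom (α : Type*) [m : MeasurableSpace α]
    [MeasurableSpace.CountablyGenerated α] :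
    ∃ C : Set (Set α), C.Countable ∧ IsPiSystem C ∧ Set.univ ∈ C ∧
      m = MeasurableSpace.generateFrom C := by
  refine ⟨generateSetAlgebra (MeasurableSpace.countableGeneratingSet α),
    countable_generateSetAlgebra MeasurableSpace.countable_countableGeneratingSet,
    fun s hs t ht _ => isSetAlgebra_generateSetAlgebra.inter_mem hs ht,
    isSetAlgebra_generateSetAlgebra.univ_mem, ?_⟩
  rw [generateFrom_generateSetAlgebra_eq, MeasurableSpace.generateFrom_countableGeneratingSet]

/-- A kernel whose measures are finite on each member of a fixed countable cover is s-finite; no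
uniform bound is needed, because the parameter space can be cut along the level sets of the
masses. -/
theorem isSFiniteKernel_of_iUnion_eq_univ {α β : Type*} {mα : MeasurableSpace α}
    {mβ : MeasurableSpace β} (κ : Kernel α β) (S : ℕ → Set β) (hS : ∀ n, MeasurableSet (S n))
    (hU : ⋃ n, S n = Set.univ) (hfin : ∀ a n, κ a (S n) < ∞) : IsSFiniteKernel κ := by
  classical
  have hT : ∀ n, MeasurableSet (disjointed S n) := fun n => MeasurableSet.disjointed hS n
  have hTfin : ∀ a n, κ a (disjointed S n) < ∞ := fun a n =>
    (measure_mono (disjointed_subset S n)).trans_lt (hfin a n)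
  have hA : ∀ q : ℕ × ℕ,
      MeasurableSet {a | ⌊(κ a (disjointed S q.1)).toNNReal⌋₊ = q.2} := fun q =>
    (Nat.measurable_floor.comp (κ.measurable_coe (hT q.1)).ennreal_toNNReal)
      (measurableSet_singleton q.2)
  let κs : ℕ × ℕ → Kernel α β := fun q =>
    Kernel.piecewise (hA q) (κ.restrict (hT q.1)) 0
  have hκs : ∀ q, IsFiniteKernel (κs q) := by
    intro q
    refine ⟨⟨q.2 + 1, by simp, fun a => ?_⟩⟩
    simp only [κs, Kernel.piecewise_apply]
    split_ifs with h
    · rw [Kernel.restrict_apply, Measure.restrict_apply_univ]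
      have h1 := Nat.lt_floor_add_one (κ a (disjointed S q.1)).toNNReal
      rw [Set.mem_ofPred_eq] at h
      rw [h] at h1
      rw [← ENNReal.coe_toNNReal (hTfin a q.1).ne]
      exact_mod_cast h1.le
    · simp
  have hsum : κ = Kernel.sum κs := by
    ext a s hs
    rw [Kernel.sum_apply' _ _ hs, ENNReal.tsum_prod (f := fun n k => κs (n, k) a s)]
    have h1 : ∀ n, ∑' k, κs (n, k) a s = κ a (s ∩ disjointed S n) := by
      intro n
      rw [tsum_eq_single ⌊(κ a (disjointed S n)).toNNReal⌋₊]
      · simp [κs, Kernel.piecewise_apply, Kernel.restrict_apply, Measure.restrict_apply hs]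
      · intro k hk
        simp [κs, Kernel.piecewise_apply, hk.symm]
    simp_rw [h1]
    rw [← measure_iUnion, ← Set.inter_iUnion, iUnion_disjointed, hU, Set.inter_univ]
    · exact fun i j hij => (disjoint_disjointed S hij).mono Set.inter_subset_right
        Set.inter_subset_right
    · exact fun n => hs.inter (hT n)
  rw [hsum]
  infer_instance

/-! ### The circumcentre -/

theorem center_isCircumcenter (K : Particle d) : IsCircumcenter K (center K) :=
  Classical.choose_spec (exists_isCircumcenter K)

theorem isCircumcenter_iff (K : Particle d) (c : Space d) :
    IsCircumcenter K c ↔ ∀ c', dist K ({c} : Particle d) ≤ dist K ({c'} : Particle d) := by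
  constructor
  · rintro ⟨r, hr, hmin⟩ c'
    exact ((subset_closedBall_iff K c r).1 hr).trans
      (hmin c' _ ((subset_closedBall_iff K c' _).2 le_rfl))
  · intro h
    exact ⟨_, (subset_closedBall_iff K c _).2 le_rfl,
      fun c' r' h' => (h c').trans ((subset_closedBall_iff K c' r').1 h')⟩

theorem dist_singleton (a b : Space d) : dist ({a} : Particle d) {b} = dist a b :=
  NonemptyCompacts.isometry_singleton.dist_eq a b

/-- The circumcentre is a continuous function for the Hausdorff metric: circumcentres of particles
close to `K` stay in a bounded set, and their only cluster point is the (unique) circumcentre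
of `K`. -/
theorem continuous_center : Continuous (center : Particle d → Space d) := by
  rw [continuous_iff_continuousAt]
  intro K
  set r := dist K {center K}
  refine (isCompact_closedBall (center K) (2 * r + 2)).tendsto_nhds_of_unique_mapClusterPt ?_ ?_
  · filter_upwards [ball_mem_nhds K one_pos] with K' hK'
    rw [mem_ball] at hK'
    rw [mem_closedBall, ← dist_singleton]
    have h1 := (isCircumcenter_iff K' _).1 (center_isCircumcenter K') (center K)
    have h2 := dist_triangle ({center K'} : Particle d) K' {center K}
    have h3 := dist_triangle K' K {center K}
    rw [dist_comm {center K'} K'] at h2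
    linarith
  · intro y _ hy
    refine IsCircumcenter.unique ?_ (center_isCircumcenter K)
    rw [isCircumcenter_iff]
    intro c'
    refine le_of_forall_pos_le_add fun ε hε => ?_
    have hfr := (mapClusterPt_iff_frequently.1 hy) _ (ball_mem_nhds y (ε := ε / 3) (by positivity))
    obtain ⟨K', hK'y, hK'⟩ :=
      (hfr.and_eventually (ball_mem_nhds K (ε := ε / 3) (by positivity))).exists
    rw [mem_ball] at hK'y
    change dist K' K < ε / 3 at hK'
    have h1 := (isCircumcenter_iff K' _).1 (center_isCircumcenter K') c'
    have h2 := dist_triangle4 K K' {center K'} {y}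
    have h3 := dist_triangle K' K {c'}
    rw [dist_singleton, dist_comm K K'] at h2
    linarith

/-! ### Measurability on the space of counting measures -/

theorem measurable_config_iff {T : Type*} [MeasurableSpace T] {f : T → Config d} :
    Measurable f ↔
      ∀ A, MeasurableSet A → Measurable fun t => (f t : Measure (Particle d)) A := by
  constructor
  · intro hf A hA
    exact (Measure.measurable_coe hA).comp (measurable_subtype_coe.comp hf)
  · intro h
    exact (Measure.measurable_of_measurable_coe _ h).subtype_mk

theorem measurable_eval {A : Set (Particle d)} (hA : MeasurableSet A) :
    Measurable fun ξ : Config d => (ξ : Measure (Particle d)) A :=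
  measurable_config_iff.1 measurable_id A hA

theorem measurable_δ : Measurable (δ : Particle d → Config d) :=
  Measure.measurable_dirac.subtype_mk

theorem measurable_restrict {A : Set (Particle d)} (hA : MeasurableSet A) :
    Measurable fun ξ : Config d => restrict ξ A := by
  rw [measurable_config_iff]
  intro s hs
  simp only [restrict, Measure.restrict_apply hs]
  exact measurable_eval (hs.inter hA)

instance instMeasurableAddConfig : MeasurableAdd₂ (Config d) := by
  refine ⟨measurable_config_iff.2 fun A hA => ?_⟩
  simp only [AddSubmonoid.coe_add, Measure.add_apply]
  exact ((measurable_eval hA).comp measurable_fst).add ((measurable_eval hA).comp measurable_snd)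

theorem iUnion_closedBall : ⋃ n : ℕ, closedBall ({0} : Particle d) n = Set.univ :=
  iUnion_closedBall_nat _

theorem monotone_closedBall : Monotone fun n : ℕ => closedBall ({0} : Particle d) n :=
  fun _ _ h => closedBall_subset_closedBall (by exact_mod_cast h)

/-- The `σ`-field of `Config d` is generated by the evaluations at `A ∩ B`, with `A` in a countable
`π`-system generating the Borel sets and `B` in a sequence of closed balls. -/
instance instCountablyGeneratedConfig : MeasurableSpace.CountablyGenerated (Config d) := by
  obtain ⟨C, hCc, hCpi, hCu, hC⟩ := exists_countable_isPiSystem_generateFrom (Particle d)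
  have : Countable C := hCc
  have hCm : ∀ s ∈ C, MeasurableSet s := fun s hs => by
    rw [hC]; exact MeasurableSpace.measurableSet_generateFrom hs
  let Φ : Config d → (C × ℕ → ℝ≥0∞) := fun ξ q =>
    (ξ : Measure (Particle d)) (q.1 ∩ closedBall {0} q.2)
  have hΦ : Measurable Φ := measurable_pi_lambda _ fun q =>
    measurable_eval ((hCm _ q.1.2).inter measurableSet_closedBall)
  have key : instMeasurableSpaceConfig d = MeasurableSpace.comap Φ inferInstance := by
    refine le_antisymm ?_ hΦ.comap_le
    -- both `σ`-fields live on `Config d`; measurability is checked for the identity map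
    let m' : MeasurableSpace (Config d) := MeasurableSpace.comap Φ inferInstance
    have hev : ∀ s ∈ C, ∀ n : ℕ, @Measurable _ _ m' _ fun ξ : Config d =>
        (ξ : Measure (Particle d)) (s ∩ closedBall {0} n) := fun s hs n =>
      (measurable_pi_apply ((⟨s, hs⟩, n) : C × ℕ)).comp (comap_measurable Φ)
    have hres : ∀ n : ℕ, @Measurable _ _ m' _ fun ξ : Config d =>
        (ξ : Measure (Particle d)).restrict (closedBall {0} n) := by
      intro n
      have : ∀ ξ : Config d,
          IsFiniteMeasure ((ξ : Measure (Particle d)).restrict (closedBall {0} n)) := fun ξ =>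
        ⟨by rw [Measure.restrict_apply_univ]; exact ξ.2.2 _ _⟩
      refine @Measurable.measure_of_isPiSystem _ _ m' _ _ this C hC hCpi (fun s hs => ?_) ?_
      · simp_rw [Measure.restrict_apply (hCm s hs)]
        exact hev s hs n
      · simp_rw [Measure.restrict_apply MeasurableSet.univ]
        exact hev _ hCu n
    have hid : @Measurable _ _ m' (instMeasurableSpaceConfig d) (id : Config d → Config d) := by
      refine (@measurable_config_iff d (Config d) m' id).2 fun A hA => ?_
      have : (fun ξ : Config d => ((id ξ : Config d) : Measure (Particle d)) A) =
          fun ξ : Config d => ⨆ n : ℕ,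
            (ξ : Measure (Particle d)).restrict (closedBall {0} n) A := by
        ext ξ
        simp_rw [Measure.restrict_apply hA]
        rw [← Monotone.measure_iUnion, ← Set.inter_iUnion, iUnion_closedBall, Set.inter_univ, id]
        exact fun i j hij => Set.inter_subset_inter_right _ (monotone_closedBall hij)
      rw [this]
      exact Measurable.iSup fun n => (Measure.measurable_coe hA).comp (hres n)
    intro s hs
    exact hid hs
  have := MeasurableSpace.CountablyGenerated.comap Φ
  rwa [← key] at this

/-- The tautological kernel `ξ ↦ ξ`. -/
noncomputable def configKernel (d : ℕ) : Kernel (Config d) (Particle d) :=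
  ⟨fun ξ => ξ, measurable_subtype_coe⟩

instance : IsSFiniteKernel (configKernel d) :=
  isSFiniteKernel_of_iUnion_eq_univ _ (fun n : ℕ => closedBall ({0} : Particle d) n)
    (fun _ => measurableSet_closedBall) iUnion_closedBall fun ξ _ => ξ.2.2 _ _

/-- The box of `p`-tuples of particles at distance at most `n` from `{0}`. -/
def box (d p n : ℕ) : Set (Fin p → Particle d) :=
  Set.univ.pi fun _ => closedBall ({0} : Particle d) n

theorem measurableSet_box (p n : ℕ) : MeasurableSet (box d p n) :=
  MeasurableSet.univ_pi fun _ => measurableSet_closedBall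

theorem monotone_box (p : ℕ) : Monotone (box d p) :=
  fun _ _ h => Set.pi_mono fun _ _ => monotone_closedBall h

theorem iUnion_box (p : ℕ) : ⋃ n, box d p n = Set.univ := by
  simp only [box]
  rw [Set.iUnion_univ_pi_of_monotone fun _ => monotone_closedBall]
  simp

theorem pi_box (p n : ℕ) (ξ : Config d) :
    Measure.pi (fun _ : Fin p => (ξ : Measure (Particle d))) (box d p n) =
      (ξ : Measure (Particle d)) (closedBall {0} n) ^ p := by
  simp [box, Measure.pi_pi]

theorem measurable_pi_config (p : ℕ) :
    Measurable fun ξ : Config d => Measure.pi fun _ : Fin p => (ξ : Measure (Particle d)) := by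
  have hres : ∀ n : ℕ, Measurable fun ξ : Config d => Measure.pi fun _ : Fin p =>
      (ξ : Measure (Particle d)).restrict (closedBall {0} n) := by
    intro n
    have hf : ∀ ξ : Config d,
        IsFiniteMeasure ((ξ : Measure (Particle d)).restrict (closedBall {0} n)) := fun ξ =>
      ⟨by rw [Measure.restrict_apply_univ]; exact ξ.2.2 _ _⟩
    refine Measurable.measure_of_isPiSystem generateFrom_pi.symm isPiSystem_pi ?_ ?_
    · rintro _ ⟨s, hs, rfl⟩
      simp_rw [Measure.pi_pi]
      refine Finset.measurable_prod _ fun i _ => ?_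
      have hsi : MeasurableSet (s i) := hs i trivial
      simp_rw [Measure.restrict_apply hsi]
      exact measurable_eval (hsi.inter measurableSet_closedBall)
    · simp_rw [Measure.pi_univ, Measure.restrict_apply_univ]
      exact Finset.measurable_prod _ fun i _ => measurable_eval measurableSet_closedBall
  refine Measure.measurable_of_measurable_coe _ fun A hA => ?_
  have : (fun ξ : Config d => Measure.pi (fun _ : Fin p => (ξ : Measure (Particle d))) A) =
      fun ξ : Config d => ⨆ n : ℕ, Measure.pi (fun _ : Fin p =>
        (ξ : Measure (Particle d)).restrict (closedBall {0} n)) A := by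
    ext ξ
    simp_rw [← Measure.restrict_pi_pi, Measure.restrict_apply hA]
    change _ = ⨆ n : ℕ, Measure.pi (fun _ : Fin p => (ξ : Measure (Particle d))) (A ∩ box d p n)
    rw [← Monotone.measure_iUnion, ← Set.inter_iUnion, iUnion_box, Set.inter_univ]
    exact fun i j hij => Set.inter_subset_inter_right _ (monotone_box p hij)
  rw [this]
  exact Measurable.iSup fun n => (Measure.measurable_coe hA).comp (hres n)

theorem measurableSet_injective (p : ℕ) :
    MeasurableSet {K : Fin p → Particle d | Function.Injective K} := by
  have : {K : Fin p → Particle d | Function.Injective K} =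
      ⋂ i, ⋂ j, ⋂ (_ : i ≠ j), {K | K i = K j}ᶜ := by
    ext K
    simp only [Set.mem_ofPred_eq, Set.mem_iInter, Set.mem_compl_iff]
    exact ⟨fun h i j hij e => hij (h e), fun h i j e => by_contra fun hij => h i j hij e⟩
  rw [this]
  exact .iInter fun i => .iInter fun j => .iInter fun _ =>
    (measurableSet_eq_fun (measurable_pi_apply i) (measurable_pi_apply j)).compl

theorem measurable_factorialMeasure (p : ℕ) :
    Measurable (factorialMeasure p : Config d → Measure (Fin p → Particle d)) := by
  refine Measure.measurable_of_measurable_coe _ fun A hA => ?_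
  simp only [factorialMeasure, Measure.restrict_apply hA]
  exact (Measure.measurable_coe (hA.inter (measurableSet_injective p))).comp
    (measurable_pi_config p)

/-- The kernel `ξ ↦ ξ^(p)`. -/
noncomputable def factorialKernel (d p : ℕ) : Kernel (Config d) (Fin p → Particle d) :=
  ⟨factorialMeasure p, measurable_factorialMeasure p⟩

theorem factorialMeasure_box_le (p n : ℕ) (ξ : Config d) :
    factorialMeasure p ξ (box d p n) ≤ (ξ : Measure (Particle d)) (closedBall {0} n) ^ p :=
  (Measure.restrict_apply_le _ _).trans_eq (pi_box p n ξ)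

instance (p : ℕ) : IsSFiniteKernel (factorialKernel d p) :=
  isSFiniteKernel_of_iUnion_eq_univ _ (box d p) (measurableSet_box p) (iUnion_box p) fun ξ n =>
    (factorialMeasure_box_le p n ξ).trans_lt (ENNReal.pow_lt_top (ξ.2.2 _ _))

/-! ### Atoms of counting measures and removal of points -/

theorem config_apply_eq_zero_of_lt_one (ξ : Config d) {A : Set (Particle d)}
    (h : (ξ : Measure (Particle d)) A < 1) : (ξ : Measure (Particle d)) A = 0 := by
  rw [← measure_toMeasurable] at h ⊢
  obtain ⟨n, hn⟩ := ξ.2.1 _ (measurableSet_toMeasurable (ξ : Measure (Particle d)) A)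
  rw [hn] at h ⊢
  have : n < 1 := by exact_mod_cast h
  rw [Order.lt_one_iff] at this
  simp [this]

/-- A locally finite integer-valued measure is purely atomic: a point that is not an atom has a
neighbourhood of mass less than one, hence zero. -/
theorem ae_singleton_ne_zero (ξ : Config d) :
    ∀ᵐ L ∂(ξ : Measure (Particle d)), (ξ : Measure (Particle d)) {L} ≠ 0 := by
  rw [ae_iff]
  refine measure_null_of_locally_null _ fun L hL => ?_
  have hL : (ξ : Measure (Particle d)) {L} = 0 := by simpa using hL
  have ht : Filter.Tendsto (fun n : ℕ => (ξ : Measure (Particle d)) (closedBall L (1 / (n + 1))))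
      Filter.atTop (nhds ((ξ : Measure (Particle d)) (⋂ n : ℕ, closedBall L (1 / (n + 1))))) := by
    refine tendsto_measure_iInter_atTop (fun n => measurableSet_closedBall.nullMeasurableSet)
      (fun i j hij => closedBall_subset_closedBall ?_) ⟨0, (ξ.2.2 _ _).ne⟩
    exact one_div_le_one_div_of_le (by positivity) (by gcongr)
  have hI : ⋂ n : ℕ, closedBall L (1 / ((n : ℝ) + 1)) = {L} := by
    ext K
    simp only [Set.mem_iInter, mem_closedBall, Set.mem_singleton_iff]
    constructor
    · intro h
      exact dist_le_zero.1 (ge_of_tendsto' tendsto_one_div_add_atTop_nhds_zero_nat h)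
    · rintro rfl n
      rw [dist_self]
      positivity
  rw [hI, hL] at ht
  obtain ⟨n, hn⟩ := (ht.eventually (gt_mem_nhds one_pos)).exists
  exact ⟨_, mem_nhdsWithin_of_mem_nhds (closedBall_mem_nhds L (by positivity)),
    config_apply_eq_zero_of_lt_one ξ hn⟩

theorem coe_sum_δ (K : Fin p → Particle d) :
    ((∑ i, δ (K i) : Config d) : Measure (Particle d)) = ∑ i, Measure.dirac (K i) := by
  rw [AddSubmonoid.coe_finsetSum]
  rfl

instance (K : Fin p → Particle d) :
    IsFiniteMeasure ((∑ i, δ (K i) : Config d) : Measure (Particle d)) := by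
  rw [coe_sum_δ]
  infer_instance

instance (K : Particle d) : IsFiniteMeasure (δ K : Measure (Particle d)) :=
  inferInstanceAs (IsFiniteMeasure (Measure.dirac K))

theorem coe_sub_of_le {ξ η : Config d} [h : IsFiniteMeasure (η : Measure (Particle d))]
    (hle : (η : Measure (Particle d)) ≤ ξ) :
    (sub ξ η : Measure (Particle d)) = (ξ : Measure (Particle d)) - η := by
  rw [sub, dif_pos ⟨h, hle⟩]

theorem sub_of_not_le {ξ η : Config d} (hle : ¬ (η : Measure (Particle d)) ≤ ξ) :
    sub ξ η = ξ := by
  rw [sub, dif_neg fun h => hle h.2]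

theorem sub_eq_of_eq_add {ξ η ζ : Config d} [IsFiniteMeasure (η : Measure (Particle d))]
    (h : ξ = ζ + η) : sub ξ η = ζ := by
  have h' : (ξ : Measure (Particle d)) = ζ + η := congrArg Subtype.val h
  have hle : (η : Measure (Particle d)) ≤ ξ := by
    rw [h']
    exact Measure.le_add_left le_rfl
  refine Subtype.ext ?_
  rw [coe_sub_of_le hle]
  refine Measure.ext fun A hA => ?_
  rw [Measure.sub_apply hA hle, h', Measure.add_apply,
    ENNReal.add_sub_cancel_right (measure_ne_top _ _)]

theorem le_sub_δ_add_one (ξ : Config d) (L : Particle d) {A : Set (Particle d)}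
    (hA : MeasurableSet A) :
    (ξ : Measure (Particle d)) A ≤ (sub ξ (δ L) : Measure (Particle d)) A + 1 := by
  by_cases hle : (δ L : Measure (Particle d)) ≤ ξ
  · rw [coe_sub_of_le hle, Measure.sub_apply hA hle]
    refine le_tsub_add.trans (add_le_add_right ?_ _)
    exact prob_le_one (μ := Measure.dirac L)
  · rw [sub_of_not_le hle]
    exact le_self_add

theorem sum_δ_le_iff (K : Fin p → Particle d) (ξ : Config d) :
    ((∑ i, δ (K i) : Config d) : Measure (Particle d)) ≤ ξ ↔
      ∀ i, ((∑ j, δ (K j) : Config d) : Measure (Particle d)) {K i} ≤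
        (ξ : Measure (Particle d)) {K i} := by
  classical
  refine ⟨fun h i => h _, fun h => Measure.le_iff.2 fun A hA => ?_⟩
  set η := ((∑ i, δ (K i) : Config d) : Measure (Particle d))
  have h0 : η (Set.range K)ᶜ = 0 := by
    change ((∑ i, δ (K i) : Config d) : Measure (Particle d)) (Set.range K)ᶜ = 0
    rw [coe_sum_δ, Measure.finsetSum_apply]
    simp [Measure.dirac_apply' _ (Set.finite_range K).measurableSet.compl]
  let t : Finset (Particle d) := (Finset.univ.image K).filter (· ∈ A)
  have ht : (t : Set (Particle d)) = A ∩ Set.range K := by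
    ext x
    simp [t, and_comm]
  calc η A ≤ η (t : Set (Particle d)) + η (Set.range K)ᶜ := by
        refine (measure_mono fun x hx => ?_).trans (measure_union_le _ _)
        rw [ht]
        by_cases hK : x ∈ Set.range K
        · exact Or.inl ⟨hx, hK⟩
        · exact Or.inr hK
    _ = ∑ x ∈ t, η {x} := by rw [h0, add_zero, sum_measure_singleton]
    _ ≤ ∑ x ∈ t, (ξ : Measure (Particle d)) {x} := by
        refine Finset.sum_le_sum fun x hx => ?_
        obtain ⟨⟨i, rfl⟩, -⟩ : (∃ i, K i = x) ∧ x ∈ A := by simpa [t] using hx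
        exact h i
    _ = (ξ : Measure (Particle d)) (t : Set (Particle d)) := by rw [sum_measure_singleton]
    _ ≤ (ξ : Measure (Particle d)) A := measure_mono (ht ▸ Set.inter_subset_left)

theorem measurable_measure_singleton :
    Measurable fun q : Config d × Particle d => (q.1 : Measure (Particle d)) {q.2} := by
  have hs : MeasurableSet {r : (Config d × Particle d) × Particle d | r.2 = r.1.2} :=
    measurableSet_eq_fun measurable_snd (measurable_snd.comp measurable_fst)
  have := Kernel.measurable_kernel_prodMk_left
    (κ := (configKernel d).comap Prod.fst (measurable_fst (β := Particle d))) hs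
  exact this

theorem measurable_sum_δ :
    Measurable fun K : Fin p → Particle d => (∑ i, δ (K i) : Config d) :=
  Finset.measurable_fun_sum _ fun i _ => measurable_δ.comp (measurable_pi_apply i)

theorem measurable_sub_sum_δ :
    Measurable fun q : Config d × (Fin p → Particle d) => sub q.1 (∑ i, δ (q.2 i)) := by
  have hη : Measurable fun q : Config d × (Fin p → Particle d) => (∑ i, δ (q.2 i) : Config d) :=
    measurable_sum_δ.comp measurable_snd
  have hle : MeasurableSet {q : Config d × (Fin p → Particle d) |
      ((∑ i, δ (q.2 i) : Config d) : Measure (Particle d)) ≤ q.1} := by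
    simp_rw [sum_δ_le_iff]
    rw [Set.ofPred_forall]
    refine MeasurableSet.iInter fun i => measurableSet_le ?_ ?_
    · exact measurable_measure_singleton.comp
        (hη.prodMk ((measurable_pi_apply i).comp measurable_snd))
    · exact measurable_measure_singleton.comp
        (measurable_fst.prodMk ((measurable_pi_apply i).comp measurable_snd))
  classical
  refine measurable_config_iff.2 fun A hA => ?_
  have : (fun q : Config d × (Fin p → Particle d) =>
      (sub q.1 (∑ i, δ (q.2 i)) : Measure (Particle d)) A) = fun q =>
      if ((∑ i, δ (q.2 i) : Config d) : Measure (Particle d)) ≤ q.1 then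
        (q.1 : Measure (Particle d)) A - ((∑ i, δ (q.2 i) : Config d) : Measure (Particle d)) A
      else (q.1 : Measure (Particle d)) A := by
    ext q
    split_ifs with h
    · rw [coe_sub_of_le h, Measure.sub_apply hA h]
    · rw [sub_of_not_le h]
  rw [this]
  exact Measurable.ite hle
    (((measurable_eval hA).comp measurable_fst).sub ((measurable_eval hA).comp hη))
    ((measurable_eval hA).comp measurable_fst)

theorem measurable_sub_δ :
    Measurable fun q : Config d × Particle d => sub q.1 (δ q.2) := by
  have h : Measurable fun q : Config d × Particle d => (q.1, fun _ : Fin 1 => q.2) :=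
    measurable_fst.prodMk (measurable_pi_lambda _ fun _ => measurable_snd)
  simpa [Function.comp_def] using measurable_sub_sum_δ.comp h

theorem measurable_config_sub_δ {T : Type*} [MeasurableSpace T] {f : T → Config d}
    {g : T → Particle d} (hf : Measurable f) (hg : Measurable g) :
    Measurable fun t => sub (f t) (δ (g t)) := by
  have h := Measurable.comp (measurable_sub_δ (d := d)) (hf.prodMk hg)
  exact h

theorem measurable_config_sub_sum_δ {T : Type*} [MeasurableSpace T] {f : T → Config d}
    {g : T → Fin p → Particle d} (hf : Measurable f) (hg : Measurable g) :
    Measurable fun t => sub (f t) (∑ i, δ (g t i)) := by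
  have h := Measurable.comp (measurable_sub_sum_δ (d := d) (p := p)) (hf.prodMk hg)
  exact h

/-! ### Configurations without multiple points -/

/-- All atoms of `ξ` have mass at most one. This is implied by `IsSimple`, which asks for the same
of the image of `ξ` under the circumcentre. -/
def HasNoMultiplePoints (ξ : Config d) : Prop :=
  ∀ K : Particle d, (ξ : Measure (Particle d)) {K} ≤ 1

theorem IsSimple.hasNoMultiplePoints {ξ : Config d} (h : IsSimple ξ) : HasNoMultiplePoints ξ :=
  fun K => (measure_mono (by simp)).trans (h (center K))

theorem HasNoMultiplePoints.restrict {ξ : Config d} (h : HasNoMultiplePoints ξ)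
    (A : Set (Particle d)) : HasNoMultiplePoints (restrict ξ A) :=
  fun K => (Measure.restrict_apply_le _ _).trans (h K)

theorem measurableSet_hasNoMultiplePoints :
    MeasurableSet {ξ : Config d | HasNoMultiplePoints ξ} := by
  have hs : MeasurableSet {q : Config d × Particle d | 1 < (q.1 : Measure (Particle d)) {q.2}} :=
    measurableSet_lt measurable_const measurable_measure_singleton
  have hm := Kernel.measurable_kernel_prodMk_left (κ := configKernel d) hs
  convert hm (measurableSet_singleton 0) using 1
  ext ξ
  change (∀ K, (ξ : Measure (Particle d)) {K} ≤ 1) ↔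
    (ξ : Measure (Particle d)) {K | 1 < (ξ : Measure (Particle d)) {K}} = 0
  constructor
  · intro h
    rw [Set.eq_empty_of_forall_notMem (s := {K | 1 < (ξ : Measure (Particle d)) {K}})
      fun K hK => (h K).not_gt hK, measure_empty]
  · intro h K
    by_contra! hK
    have : (ξ : Measure (Particle d)) {K} ≤ 0 := h ▸ measure_mono (by simpa using hK)
    exact absurd (hK.trans_le this) (by simp)

theorem HasNoMultiplePoints.singleton_eq_one {ξ : Config d} (h : HasNoMultiplePoints ξ)
    {L : Particle d} (hL : (ξ : Measure (Particle d)) {L} ≠ 0) :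
    (ξ : Measure (Particle d)) {L} = 1 :=
  (h L).antisymm (not_lt.1 fun hlt => hL (config_apply_eq_zero_of_lt_one ξ hlt))

theorem restrict_compl_add_restrict (ξ : Config d) {A : Set (Particle d)} (hA : MeasurableSet A) :
    restrict ξ Aᶜ + restrict ξ A = ξ :=
  Subtype.ext (Measure.restrict_compl_add_restrict hA)

theorem HasNoMultiplePoints.restrict_range {ξ : Config d} (h : HasNoMultiplePoints ξ)
    {K : Fin p → Particle d} (hK : Function.Injective K)
    (hatom : ∀ i, (ξ : Measure (Particle d)) {K i} ≠ 0) :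
    ParticleGibbs.restrict ξ (Set.range K) = ∑ i, δ (K i) := by
  classical
  refine Subtype.ext (Measure.ext fun A hA => ?_)
  rw [coe_sum_δ, Measure.finsetSum_apply, ParticleGibbs.restrict, Measure.restrict_apply hA]
  have hset : A ∩ Set.range K = ⋃ i ∈ Finset.univ.filter (fun i => K i ∈ A), {K i} := by
    ext x
    simp only [Set.mem_inter_iff, Set.mem_range, Finset.mem_filter_univ, Set.mem_iUnion,
      Set.mem_singleton_iff, exists_prop]
    constructor
    · rintro ⟨hx, i, rfl⟩
      exact ⟨i, hx, rfl⟩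
    · rintro ⟨i, hx, rfl⟩
      exact ⟨hx, i, rfl⟩
  rw [hset, measure_biUnion_finset (fun i _ j _ hij => by simpa using hK.ne hij)
    fun i _ => measurableSet_singleton _, Finset.sum_filter]
  refine Finset.sum_congr rfl fun i _ => ?_
  rw [Measure.dirac_apply' _ hA, h.singleton_eq_one (hatom i)]
  by_cases hi : K i ∈ A <;> simp [hi]

theorem HasNoMultiplePoints.eq_add_sum_δ {ξ : Config d} (h : HasNoMultiplePoints ξ)
    {K : Fin p → Particle d} (hK : Function.Injective K)
    (hatom : ∀ i, (ξ : Measure (Particle d)) {K i} ≠ 0) :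
    ξ = ParticleGibbs.restrict ξ (Set.range K)ᶜ + ∑ i, δ (K i) := by
  rw [← h.restrict_range hK hatom,
    restrict_compl_add_restrict ξ (Set.finite_range K).measurableSet]

theorem HasNoMultiplePoints.sub_sum_δ {ξ : Config d} (h : HasNoMultiplePoints ξ)
    {K : Fin p → Particle d} (hK : Function.Injective K)
    (hatom : ∀ i, (ξ : Measure (Particle d)) {K i} ≠ 0) :
    sub ξ (∑ i, δ (K i)) = ParticleGibbs.restrict ξ (Set.range K)ᶜ :=
  sub_eq_of_eq_add (h.eq_add_sum_δ hK hatom)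

theorem HasNoMultiplePoints.sub_δ {ξ : Config d} (h : HasNoMultiplePoints ξ) {L : Particle d}
    (hatom : (ξ : Measure (Particle d)) {L} ≠ 0) :
    sub ξ (δ L) = ParticleGibbs.restrict ξ {L}ᶜ := by
  simpa using h.sub_sum_δ (K := fun _ : Fin 1 => L) (Function.injective_of_subsingleton _)
    fun _ => hatom

theorem ae_factorialMeasure (ξ : Config d) :
    ∀ᵐ K ∂(factorialMeasure p ξ), Function.Injective K ∧
      ∀ i, (ξ : Measure (Particle d)) {K i} ≠ 0 := by
  refine Filter.Eventually.and (ae_restrict_mem (measurableSet_injective p)) ?_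
  refine ae_restrict_of_ae (ae_all_iff.2 fun i => ?_)
  exact (Measure.quasiMeasurePreserving_eval
    (fun _ : Fin p => (ξ : Measure (Particle d))) i).ae (ae_singleton_ne_zero ξ)

/-- For a configuration `ξ` without multiple points, choosing `p` distinct points of `ξ` and then
a further one is the same as choosing one point first and then `p` distinct points among the
others: both sides are the integral with respect to the `(p + 1)`-th factorial measure. -/
theorem HasNoMultiplePoints.lintegral_factorialMeasure_sub {ξ : Config d}
    (h : HasNoMultiplePoints ξ) {g : (Fin p → Particle d) → Particle d → Config d → ℝ≥0∞}
    (hg : Measurable fun q : (Fin p → Particle d) × Particle d × Config d => g q.1 q.2.1 q.2.2) :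
    ∫⁻ K, ∫⁻ L, g K L (sub (sub ξ (∑ i, δ (K i))) (δ L))
        ∂(sub ξ (∑ i, δ (K i)) : Measure (Particle d)) ∂(factorialMeasure p ξ) =
      ∫⁻ L, ∫⁻ K, g K L (sub (sub ξ (δ L)) (∑ i, δ (K i)))
        ∂(factorialMeasure p (sub ξ (δ L))) ∂(ξ : Measure (Particle d)) := by
  classical
  -- the common integrand, a measurable function of `(K, L)` for fixed `ξ`
  let u : (Fin p → Particle d) → Particle d → ℝ≥0∞ := fun K L =>
    g K L (sub (sub ξ (∑ i, δ (K i))) (δ L))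
  have hu : Measurable (Function.uncurry u) := by
    have h1 : Measurable fun q : (Fin p → Particle d) × Particle d =>
        sub (sub ξ (∑ i, δ (q.1 i))) (δ q.2) :=
      measurable_config_sub_δ (measurable_config_sub_sum_δ measurable_const measurable_fst)
        measurable_snd
    have h2 : Measurable fun q : (Fin p → Particle d) × Particle d =>
        (q.1, q.2, sub (sub ξ (∑ i, δ (q.1 i))) (δ q.2)) :=
      measurable_fst.prodMk (measurable_snd.prodMk h1)
    exact hg.comp h2
  let D : Set ((Fin p → Particle d) × Particle d) := {q | ∀ i, q.1 i ≠ q.2}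
  have hD : MeasurableSet D := by
    simp only [D]
    rw [Set.ofPred_forall]
    exact .iInter fun i => (measurableSet_eq_fun ((measurable_pi_apply i).comp measurable_fst)
      measurable_snd).compl
  have hv : Measurable (D.indicator (Function.uncurry u)) := hu.indicator hD
  have hleft : ∀ K, Function.Injective K → (∀ i, (ξ : Measure (Particle d)) {K i} ≠ 0) →
      ∫⁻ L, u K L ∂(sub ξ (∑ i, δ (K i)) : Measure (Particle d)) =
        ∫⁻ L, D.indicator (Function.uncurry u) (K, L) ∂(ξ : Measure (Particle d)) := by
    intro K hK hatom
    rw [h.sub_sum_δ hK hatom]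
    change ∫⁻ L in (Set.range K)ᶜ, u K L ∂(ξ : Measure (Particle d)) = _
    rw [← lintegral_indicator (Set.finite_range K).measurableSet.compl]
    refine lintegral_congr fun L => ?_
    simp [Set.indicator_apply, D, Function.uncurry]
  have hright : ∀ L, (ξ : Measure (Particle d)) {L} ≠ 0 →
      ∫⁻ K, g K L (sub (sub ξ (δ L)) (∑ i, δ (K i))) ∂(factorialMeasure p (sub ξ (δ L))) =
        ∫⁻ K, D.indicator (Function.uncurry u) (K, L) ∂(factorialMeasure p ξ) := by
    intro L hL
    have hη : sub ξ (δ L) = ParticleGibbs.restrict ξ {L}ᶜ := h.sub_δ hL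
    have hcongr : ∀ᵐ K ∂(factorialMeasure p (sub ξ (δ L))),
        g K L (sub (sub ξ (δ L)) (∑ i, δ (K i))) = u K L := by
      rw [hη]
      filter_upwards [ae_factorialMeasure (p := p) (ParticleGibbs.restrict ξ {L}ᶜ)]
        with K ⟨hK, hatom⟩
      have hKL : ∀ i, K i ≠ L := by
        intro i hi
        refine hatom i ?_
        simp [ParticleGibbs.restrict, Measure.restrict_apply, hi]
      have hatom' : ∀ i, (ξ : Measure (Particle d)) {K i} ≠ 0 := fun i h0 =>
        hatom i (le_antisymm ((Measure.restrict_apply_le _ _).trans h0.le) bot_le)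
      have hL' : (ParticleGibbs.restrict ξ (Set.range K)ᶜ : Measure (Particle d)) {L} ≠ 0 := by
        rw [ParticleGibbs.restrict, Measure.restrict_apply (measurableSet_singleton L),
          Set.inter_eq_left.2 (by simpa using hKL)]
        exact hL
      simp only [u]
      rw [(h.restrict _).sub_sum_δ hK hatom, h.sub_sum_δ hK hatom', (h.restrict _).sub_δ hL']
      congr 1
      refine Subtype.ext ?_
      simp only [ParticleGibbs.restrict]
      rw [Measure.restrict_restrict (Set.finite_range K).measurableSet.compl,
        Measure.restrict_restrict (measurableSet_singleton L).compl, Set.inter_comm]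
    rw [lintegral_congr_ae hcongr, hη]
    have hpi : factorialMeasure p (ParticleGibbs.restrict ξ {L}ᶜ) =
        (factorialMeasure p ξ).restrict (Set.univ.pi fun _ => {L}ᶜ) := by
      simp only [factorialMeasure, ParticleGibbs.restrict]
      rw [← Measure.restrict_pi_pi, Measure.restrict_restrict (measurableSet_injective p),
        Measure.restrict_restrict (MeasurableSet.univ_pi fun _ => (measurableSet_singleton L).compl),
        Set.inter_comm]
    rw [hpi, ← lintegral_indicator
      (MeasurableSet.univ_pi fun _ => (measurableSet_singleton L).compl)]
    refine lintegral_congr fun K => ?_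
    simp [Set.indicator_apply, D, Function.uncurry]
  have : SFinite (factorialMeasure p ξ) := inferInstanceAs (SFinite (factorialKernel d p ξ))
  calc _ = ∫⁻ K, ∫⁻ L, D.indicator (Function.uncurry u) (K, L) ∂(ξ : Measure (Particle d))
        ∂(factorialMeasure p ξ) := by
        refine lintegral_congr_ae ?_
        filter_upwards [ae_factorialMeasure (p := p) ξ] with K hK
        exact hleft K hK.1 hK.2
    _ = ∫⁻ L, ∫⁻ K, D.indicator (Function.uncurry u) (K, L) ∂(factorialMeasure p ξ)
        ∂(ξ : Measure (Particle d)) := lintegral_lintegral_swap hv.aemeasurable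
    _ = _ := by
        refine lintegral_congr_ae ?_
        filter_upwards [ae_singleton_ne_zero ξ] with L hL
        exact (hright L hL).symm

/-! ### From the integrated to the pointwise GNZ equation -/

/-- The measure on `Particle d × Config d` given by the left-hand side of the GNZ equation
(the reduced Campbell measure of `P`). -/
noncomputable def reducedCampbell (P : Measure (Config d)) : Measure (Particle d × Config d) :=
  (P ⊗ₘ configKernel d).map fun q => (q.2, sub q.1 (δ q.2))

theorem lintegral_reducedCampbell {P : Measure (Config d)} [SFinite P]
    {f : Particle d × Config d → ℝ≥0∞} (hf : Measurable f) :
    ∫⁻ q, f q ∂(reducedCampbell P) =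
      ∫⁻ ξ, ∫⁻ L, f (L, sub ξ (δ L)) ∂(ξ : Measure (Particle d)) ∂P := by
  have hm : Measurable fun q : Config d × Particle d => (q.2, sub q.1 (δ q.2)) :=
    measurable_snd.prodMk measurable_sub_δ
  rw [reducedCampbell, lintegral_map hf hm, Measure.lintegral_compProd
    (f := fun q : Config d × Particle d => f (q.2, sub q.1 (δ q.2))) (hf.comp hm)]
  rfl

/-- The measure on `Particle d × Config d` given by the right-hand side of the GNZ equation. -/
noncomputable def gnzMeasure (μ : Measure (Particle d)) (lam : ℝ≥0)
    (κ : Particle d → Config d → ℝ≥0) (P : Measure (Config d)) :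
    Measure (Particle d × Config d) :=
  lam • (((P.prod μ).map Prod.swap).withDensity fun q => (κ q.1 q.2 : ℝ≥0∞))

theorem lintegral_gnzMeasure {μ : Measure (Particle d)} [SFinite μ] {lam : ℝ≥0}
    {κ : Particle d → Config d → ℝ≥0} (hκ : Measurable (Function.uncurry κ))
    {P : Measure (Config d)} [SFinite P]
    {f : Particle d × Config d → ℝ≥0∞} (hf : Measurable f) :
    ∫⁻ q, f q ∂(gnzMeasure μ lam κ P) = lam * ∫⁻ ξ, ∫⁻ L, f (L, ξ) * κ L ξ ∂μ ∂P := by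
  have hκ' : Measurable fun q : Particle d × Config d => (κ q.1 q.2 : ℝ≥0∞) :=
    measurable_coe_nnreal_ennreal.comp hκ
  rw [gnzMeasure, lintegral_smul_measure, lintegral_withDensity_eq_lintegral_mul _ hκ' hf,
    lintegral_map (hκ'.mul hf) measurable_swap,
    lintegral_prod (fun q : Config d × Particle d =>
      ((fun q : Particle d × Config d => (κ q.1 q.2 : ℝ≥0∞)) * f) q.swap)
      ((hκ'.mul hf).comp measurable_swap).aemeasurable, ENNReal.smul_def, smul_eq_mul]
  simp only [Pi.mul_apply, Prod.swap, mul_comm]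

/-- The sets `{(L, ξ) | L ∈ B_n, ξ(B_n) ≤ k}`, which exhaust `Particle d × Config d` and on which
reduced Campbell measures are finite. -/
def finiteMassSet (d : ℕ) (q : ℕ × ℕ) : Set (Particle d × Config d) :=
  closedBall {0} q.1 ×ˢ {ξ : Config d | (ξ : Measure (Particle d)) (closedBall {0} q.1) ≤ q.2}

theorem measurableSet_finiteMassSet (q : ℕ × ℕ) : MeasurableSet (finiteMassSet d q) :=
  measurableSet_closedBall.prod
    (measurableSet_le (measurable_eval measurableSet_closedBall) measurable_const)

theorem iUnion_finiteMassSet : ⋃ q, finiteMassSet d q = Set.univ := by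
  refine Set.eq_univ_of_forall fun ⟨L, ξ⟩ => ?_
  obtain ⟨n, hn⟩ := exists_nat_ge (dist L ({0} : Particle d))
  obtain ⟨k, hk⟩ := ENNReal.exists_nat_gt (ξ.2.2 {0} n).ne
  exact Set.mem_iUnion.2 ⟨(n, k), hn, hk.le⟩

theorem reducedCampbell_finiteMassSet_lt_top (P : Measure (Config d)) [IsFiniteMeasure P]
    (q : ℕ × ℕ) : reducedCampbell P (finiteMassSet d q) < ∞ := by
  rw [← lintegral_indicator_one (measurableSet_finiteMassSet q),
    lintegral_reducedCampbell (measurable_one.indicator (measurableSet_finiteMassSet q))]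
  refine lt_of_le_of_lt (b := ∫⁻ _ : Config d, ((q.2 : ℝ≥0∞) + 1) ∂P) ?_ ?_
  · refine lintegral_mono fun ξ => ?_
    by_cases hξ : (ξ : Measure (Particle d)) (closedBall {0} q.1) ≤ q.2 + 1
    · refine le_trans ?_ hξ
      rw [← lintegral_indicator_one measurableSet_closedBall]
      refine lintegral_mono fun L => ?_
      refine Set.indicator_le_indicator_of_subset (s := {L | (L, sub ξ (δ L)) ∈ finiteMassSet d q})
        (f := fun _ : Particle d => (1 : ℝ≥0∞)) (fun L hL => hL.1) (fun _ => zero_le_one) L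
    · -- removing one point lowers the mass of the ball by at most one
      refine le_of_eq_of_le ?_ bot_le
      rw [bot_eq_zero, ← lintegral_zero (μ := (ξ : Measure (Particle d)))]
      refine lintegral_congr fun L => Set.indicator_of_notMem (fun hL => hξ ?_) _
      exact (le_sub_δ_add_one ξ L measurableSet_closedBall).trans (add_le_add_left hL.2 1)
  · rw [lintegral_const]
    exact ENNReal.mul_lt_top (by simp) (measure_lt_top _ _)

/-- If the GNZ equation holds in integrated form with respect to a `σ`-finite measure on the
parameter `t`, then it holds for almost every `t`, simultaneously for all test functions. Two
measures on the countably generated space `Particle d × Config d` have to be compared, and the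
left one is finite on the sets `finiteMassSet`. -/
theorem ae_isGibbs_of_lintegral {T : Type*} [MeasurableSpace T] {α : Measure T} [SigmaFinite α]
    {μ : Measure (Particle d)} [SFinite μ] {lam : ℝ≥0} (R : Kernel T (Config d))
    [IsMarkovKernel R] {κ : T → Particle d → Config d → ℝ≥0}
    (hκ : Measurable fun q : T × Particle d × Config d => κ q.1 q.2.1 q.2.2)
    (h : ∀ F : T → Particle d → Config d → ℝ≥0∞,
      Measurable (fun q : T × Particle d × Config d => F q.1 q.2.1 q.2.2) →
      ∫⁻ t, ∫⁻ ξ, ∫⁻ L, F t L (sub ξ (δ L)) ∂(ξ : Measure (Particle d)) ∂(R t) ∂α =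
        ∫⁻ t, lam * ∫⁻ ξ, ∫⁻ L, F t L ξ * κ t L ξ ∂μ ∂(R t) ∂α) :
    ∀ᵐ t ∂α, IsGibbs μ lam (κ t) (R t) := by
  classical
  have hκt : ∀ t, Measurable (Function.uncurry (κ t)) := fun t => hκ.comp measurable_prodMk_left
  have hκ' : Measurable fun q : T × Particle d × Config d => (κ q.1 q.2.1 q.2.2 : ℝ≥0∞) :=
    measurable_coe_nnreal_ennreal.comp hκ
  have hM : ∀ D, MeasurableSet D → Measurable fun t => reducedCampbell (R t) D := by
    intro D hD
    simp_rw [← lintegral_indicator_one hD,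
      lintegral_reducedCampbell (measurable_one.indicator hD)]
    refine Measurable.lintegral_kernel (f := fun ξ : Config d => ∫⁻ L,
      D.indicator 1 (L, sub ξ (δ L)) ∂(ξ : Measure (Particle d))) ?_
    refine Measurable.lintegral_kernel_prod_right (κ := configKernel d)
      (f := fun ξ L => D.indicator 1 (L, sub ξ (δ L))) ?_
    exact (measurable_one.indicator hD).comp (measurable_snd.prodMk measurable_sub_δ)
  have hN : ∀ D, MeasurableSet D → Measurable fun t => gnzMeasure μ lam (κ t) (R t) D := by
    intro D hD
    simp_rw [← lintegral_indicator_one hD,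
      lintegral_gnzMeasure (hκt _) (measurable_one.indicator hD)]
    refine Measurable.const_mul ?_ _
    refine Measurable.lintegral_kernel_prod_right (κ := R)
      (f := fun t ξ => ∫⁻ L, D.indicator 1 (L, ξ) * (κ t L ξ : ℝ≥0∞) ∂μ) ?_
    refine Measurable.lintegral_prod_right' (ν := μ)
      (f := fun q : (T × Config d) × Particle d =>
        D.indicator 1 (q.2, q.1.2) * (κ q.1.1 q.2 q.1.2 : ℝ≥0∞)) ?_
    refine Measurable.mul ((measurable_one.indicator hD).comp (by fun_prop)) ?_
    exact hκ'.comp (f := fun q : (T × Config d) × Particle d => (q.1.1, q.2, q.1.2)) (by fun_prop)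
  have hae : ∀ D, MeasurableSet D →
      ∀ᵐ t ∂α, reducedCampbell (R t) D = gnzMeasure μ lam (κ t) (R t) D := by
    intro D hD
    refine ae_eq_of_forall_setLIntegral_eq_of_sigmaFinite (hM D hD) (hN D hD) fun s hs _ => ?_
    have hF := h (fun t L ξ => s.indicator 1 t * D.indicator 1 (L, ξ))
      (((measurable_one.indicator hs).comp measurable_fst).mul
        ((measurable_one.indicator hD).comp measurable_snd))
    rw [← lintegral_indicator hs, ← lintegral_indicator hs]
    convert hF using 1
    · refine lintegral_congr fun t => ?_
      by_cases ht : t ∈ s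
      · simp only [Set.indicator_of_mem ht, Pi.one_apply, one_mul]
        rw [← lintegral_indicator_one hD,
          lintegral_reducedCampbell (measurable_one.indicator hD)]
      · simp [Set.indicator_of_notMem ht]
    · refine lintegral_congr fun t => ?_
      by_cases ht : t ∈ s
      · simp only [Set.indicator_of_mem ht, Pi.one_apply, one_mul]
        rw [← lintegral_indicator_one hD,
          lintegral_gnzMeasure (hκt t) (measurable_one.indicator hD)]
      · simp [Set.indicator_of_notMem ht]
  obtain ⟨C, hCc, hCpi, hCu, hC⟩ :=
    exists_countable_isPiSystem_generateFrom (Particle d × Config d)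
  have hCm : ∀ D ∈ C, MeasurableSet D := fun D hD => by
    rw [hC]; exact MeasurableSpace.measurableSet_generateFrom hD
  have hall : ∀ᵐ t ∂α, ∀ q : ℕ × ℕ, ∀ D ∈ C,
      reducedCampbell (R t) (D ∩ finiteMassSet d q) =
        gnzMeasure μ lam (κ t) (R t) (D ∩ finiteMassSet d q) :=
    ae_all_iff.2 fun q => (ae_ball_iff hCc).2 fun D hD =>
      hae _ ((hCm D hD).inter (measurableSet_finiteMassSet q))
  filter_upwards [hall] with t ht
  have heq : reducedCampbell (R t) = gnzMeasure μ lam (κ t) (R t) := by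
    refine (Measure.ext_iff_of_iUnion_eq_univ (iUnion_finiteMassSet (d := d))).2 fun q => ?_
    have : IsFiniteMeasure ((reducedCampbell (R t)).restrict (finiteMassSet d q)) :=
      ⟨by rw [Measure.restrict_apply_univ]; exact reducedCampbell_finiteMassSet_lt_top _ q⟩
    have hD : ∀ D ∈ C, (reducedCampbell (R t)).restrict (finiteMassSet d q) D =
        (gnzMeasure μ lam (κ t) (R t)).restrict (finiteMassSet d q) D := fun D hD => by
      rw [Measure.restrict_apply (hCm D hD), Measure.restrict_apply (hCm D hD), ht q D hD]
    exact ext_of_generate_finite C hC hCpi hD (hD _ hCu)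
  refine ⟨inferInstance, hκt t, fun f hf => ?_⟩
  have := lintegral_reducedCampbell (P := R t) hf
  rw [heq, lintegral_gnzMeasure (hκt t) hf] at this
  exact this.symm

/-! ### Reduced Palm distributions of Gibbs distributions -/

/-- The factorial moment measure need not be `σ`-finite in general, but it is so as soon as Palm
distributions, being probability measures, exist: it is finite on the set of those `K` in a box for
which the Palm distribution gives mass at least `1 / 2` to the event that a fixed ball contains at
most `k` points. -/
theorem IsPalm.sigmaFinite {P : Measure (Config d)} [IsProbabilityMeasure P]
    {R : Kernel (Fin p → Particle d) (Config d)} (h : IsPalm p P R) :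
    SigmaFinite (factorialMomentMeasure p P) := by
  have hR := h.1
  let E : ℕ × ℕ → Set (Config d) := fun q =>
    {ξ | (ξ : Measure (Particle d)) (closedBall {0} q.1) ≤ q.2}
  have hE : ∀ q, MeasurableSet (E q) := fun q =>
    measurableSet_le (measurable_eval measurableSet_closedBall) measurable_const
  let f : ℕ × ℕ → (Fin p → Particle d) → Config d → ℝ≥0∞ := fun q K ξ =>
    (box d p q.1).indicator 1 K * (E q).indicator 1 ξ
  have hf : ∀ q, Measurable (Function.uncurry (f q)) := fun q =>
    ((measurable_one.indicator (measurableSet_box p q.1)).comp measurable_fst).mul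
      ((measurable_one.indicator (hE q)).comp measurable_snd)
  have hint : ∀ q K, ∫⁻ ξ, f q K ξ ∂(R K) = (box d p q.1).indicator 1 K * R K (E q) := by
    intro q K
    simp only [f]
    rw [lintegral_const_mul _ (measurable_one.indicator (hE q)), lintegral_indicator_one (hE q)]
  let S : ℕ × ℕ → Set (Fin p → Particle d) := fun q => {K | 2⁻¹ ≤ ∫⁻ ξ, f q K ξ ∂(R K)}
  have hSfin : ∀ q, factorialMomentMeasure p P (S q) < ∞ := by
    intro q
    have h1 : 2⁻¹ * factorialMomentMeasure p P (S q) ≤ (q.2 : ℝ≥0∞) ^ p := by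
      refine (mul_meas_ge_le_lintegral (Measurable.lintegral_kernel_prod_right (hf q)) _).trans ?_
      rw [← h.2 _ (hf q)]
      refine (lintegral_mono (g := fun _ => (q.2 : ℝ≥0∞) ^ p) fun ξ => ?_).trans (by simp)
      simp only [f]
      rw [lintegral_mul_const _ (measurable_one.indicator (measurableSet_box p q.1)),
        lintegral_indicator_one (measurableSet_box p q.1)]
      by_cases hξ : ξ ∈ E q
      · rw [Set.indicator_of_mem hξ, Pi.one_apply, mul_one]
        exact (factorialMeasure_box_le p q.1 ξ).trans (pow_le_pow_left' hξ p)
      · simp [Set.indicator_of_notMem hξ]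
    have h2 : 2⁻¹ * factorialMomentMeasure p P (S q) < ∞ := h1.trans_lt (by simp)
    by_contra h3
    rw [not_lt, top_le_iff] at h3
    rw [h3, ENNReal.mul_top (by simp)] at h2
    exact lt_irrefl _ h2
  refine Measure.sigmaFinite_of_countable (S := Set.range S) (Set.countable_range S) ?_ ?_
  · rintro _ ⟨q, rfl⟩
    exact hSfin q
  · refine Set.eq_univ_of_forall fun K => ?_
    obtain ⟨m, hm⟩ := Set.mem_iUnion.1 ((iUnion_box p).ge (Set.mem_univ K))
    have hmono : Monotone fun k => E (m, k) := fun i j hij ξ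
        (hξ : (ξ : Measure (Particle d)) (closedBall {0} m) ≤ i) =>
      hξ.trans (by exact_mod_cast hij)
    have hU : ⋃ k, E (m, k) = Set.univ := by
      refine Set.eq_univ_of_forall fun ξ => ?_
      obtain ⟨k, hk⟩ := ENNReal.exists_nat_gt (ξ.2.2 {0} m).ne
      exact Set.mem_iUnion.2 ⟨k, hk.le⟩
    have ht := tendsto_measure_iUnion_atTop (μ := R K) hmono
    rw [hU, measure_univ] at ht
    obtain ⟨k, hk⟩ := (ht.eventually (lt_mem_nhds ENNReal.one_half_lt_one)).exists
    refine Set.mem_sUnion.2 ⟨S (m, k), ⟨_, rfl⟩, ?_⟩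
    change 2⁻¹ ≤ ∫⁻ ξ, f (m, k) K ξ ∂(R K)
    rw [hint, Set.indicator_of_mem hm, Pi.one_apply, one_mul]
    exact hk.le

/-- The reduced Palm distributions as a kernel. -/
noncomputable def reducedPalmKernel (R : Kernel (Fin p → Particle d) (Config d))
    [IsMarkovKernel R] : Kernel (Fin p → Particle d) (Config d) :=
  ⟨reducedPalm R, by
    refine Measure.measurable_of_measurable_coe _ fun A hA => ?_
    have hm : Measurable fun q : (Fin p → Particle d) × Config d =>
        sub q.2 (∑ i, δ (q.1 i)) := measurable_config_sub_sum_δ measurable_snd measurable_fst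
    have hmap : ∀ K, reducedPalm R K A = R K {ξ | sub ξ (∑ i, δ (K i)) ∈ A} := fun K =>
      Measure.map_apply (measurable_config_sub_sum_δ measurable_id measurable_const) hA
    simp_rw [hmap]
    exact Kernel.measurable_kernel_prodMk_left (hm hA)⟩

theorem lintegral_reducedPalmKernel (R : Kernel (Fin p → Particle d) (Config d))
    [IsMarkovKernel R] (K : Fin p → Particle d) {f : Config d → ℝ≥0∞} (hf : Measurable f) :
    ∫⁻ ξ, f ξ ∂(reducedPalmKernel R K) = ∫⁻ ξ, f (sub ξ (∑ i, δ (K i))) ∂(R K) :=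
  lintegral_map hf (measurable_config_sub_sum_δ measurable_id measurable_const)

instance (R : Kernel (Fin p → Particle d) (Config d)) [IsMarkovKernel R] :
    IsMarkovKernel (reducedPalmKernel R) :=
  ⟨fun _ => Measure.isProbabilityMeasure_map
    (measurable_config_sub_sum_δ measurable_id measurable_const).aemeasurable⟩

/-- The reduced Palm distributions of a Gibbs distribution without multiple points are Gibbs, with
the Palm points added to the boundary condition. The GNZ equation of `P` is applied to
`(L, η) ↦ ∫ F(K, L, η - ∑ δ_{K_i}) η^(p)(dK)`; the iterated integrals are rearranged by
`HasNoMultiplePoints.lintegral_factorialMeasure_sub`. -/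
theorem IsGibbs.ae_reducedPalm {μ : Measure (Particle d)} [SFinite μ] {lam : ℝ≥0}
    {κ : Particle d → Config d → ℝ≥0} {P : Measure (Config d)} (hP : IsGibbs μ lam κ P)
    (hs : ∀ᵐ ξ ∂P, HasNoMultiplePoints ξ) {R : Kernel (Fin p → Particle d) (Config d)}
    (hR : IsPalm p P R) :
    ∀ᵐ K ∂(factorialMomentMeasure p P),
      IsGibbs μ lam (fun L ξ => κ L (ξ + ∑ i, δ (K i))) (reducedPalm R K) := by
  have := hP.isProbabilityMeasure
  have := hR.1
  have := hR.sigmaFinite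
  have hκ : Measurable (Function.uncurry κ) := hP.measurable_papangelou
  have hκ' : Measurable fun q : (Fin p → Particle d) × Particle d × Config d =>
      κ q.2.1 (q.2.2 + ∑ i, δ (q.1 i)) := by
    have h1 : Measurable fun q : (Fin p → Particle d) × Particle d × Config d =>
        (q.2.1, q.2.2 + ∑ i, δ (q.1 i)) :=
      (measurable_fst.comp measurable_snd).prodMk
        ((measurable_snd.comp measurable_snd).add (measurable_sum_δ.comp measurable_fst))
    exact hκ.comp h1
  refine ae_isGibbs_of_lintegral (reducedPalmKernel R) hκ' fun F hF => ?_
  -- the inner integrals, as functions of the Palm points and of the remaining configuration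
  let l : (Fin p → Particle d) → Config d → ℝ≥0∞ := fun K ξ =>
    ∫⁻ L, F K L (sub ξ (δ L)) ∂(ξ : Measure (Particle d))
  let r : (Fin p → Particle d) → Config d → ℝ≥0∞ := fun K ξ =>
    ∫⁻ L, F K L ξ * κ L (ξ + ∑ i, δ (K i)) ∂μ
  have hl : Measurable (Function.uncurry l) := by
    have h1 : Measurable fun q : ((Fin p → Particle d) × Config d) × Particle d =>
        (q.1.1, q.2, sub q.1.2 (δ q.2)) :=
      (measurable_fst.comp measurable_fst).prodMk (measurable_snd.prodMk
        (measurable_config_sub_δ (measurable_snd.comp measurable_fst) measurable_snd))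
    exact Measurable.lintegral_kernel_prod_right'
      (κ := (configKernel d).comap Prod.snd (measurable_snd (α := Fin p → Particle d)))
      (hF.comp h1)
  have hr : Measurable (Function.uncurry r) := by
    have h1 : Measurable fun q : ((Fin p → Particle d) × Config d) × Particle d =>
        (q.1.1, q.2, q.1.2) := by fun_prop
    exact Measurable.lintegral_prod_right' (ν := μ)
      ((hF.comp h1).mul (measurable_coe_nnreal_ennreal.comp (hκ'.comp h1)))
  have hsub : Measurable fun q : (Fin p → Particle d) × Config d =>
      (q.1, sub q.2 (∑ i, δ (q.1 i))) :=
    measurable_fst.prodMk (measurable_config_sub_sum_δ measurable_snd measurable_fst)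
  have hpalm : ∀ u : (Fin p → Particle d) → Config d → ℝ≥0∞, Measurable (Function.uncurry u) →
      ∫⁻ K, ∫⁻ ξ, u K ξ ∂(reducedPalmKernel R K) ∂(factorialMomentMeasure p P) =
        ∫⁻ ξ, ∫⁻ K, u K (sub ξ (∑ i, δ (K i))) ∂(factorialMeasure p ξ) ∂P := by
    intro u hu
    rw [hR.2 (fun K ξ => u K (sub ξ (∑ i, δ (K i)))) (hu.comp hsub)]
    exact lintegral_congr fun K =>
      lintegral_reducedPalmKernel R K (hu.comp measurable_prodMk_left)
  have hF' : ∀ L, Measurable fun q : (Fin p → Particle d) × Config d =>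
      F q.1 L (sub q.2 (∑ i, δ (q.1 i))) := fun L => by
    have h1 : Measurable fun q : (Fin p → Particle d) × Config d =>
        (q.1, L, sub q.2 (∑ i, δ (q.1 i))) :=
      measurable_fst.prodMk (measurable_const.prodMk (measurable_snd.comp hsub))
    exact hF.comp h1
  let G : Particle d → Config d → ℝ≥0∞ := fun L η =>
    ∫⁻ K, F K L (sub η (∑ i, δ (K i))) ∂(factorialMeasure p η)
  have hG : Measurable (Function.uncurry G) := by
    have h1 : Measurable fun q : (Particle d × Config d) × (Fin p → Particle d) =>
        (q.2, q.1.1, sub q.1.2 (∑ i, δ (q.2 i))) :=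
      measurable_snd.prodMk ((measurable_fst.comp measurable_fst).prodMk
        (measurable_config_sub_sum_δ (measurable_snd.comp measurable_fst) measurable_snd))
    exact Measurable.lintegral_kernel_prod_right'
      (κ := (factorialKernel d p).comap Prod.snd (measurable_snd (α := Particle d)))
      (hF.comp h1)
  rw [lintegral_const_mul _ (Measurable.lintegral_kernel_prod_right hr)]
  calc ∫⁻ K, ∫⁻ ξ, l K ξ ∂(reducedPalmKernel R K) ∂(factorialMomentMeasure p P)
      = ∫⁻ ξ, ∫⁻ K, l K (sub ξ (∑ i, δ (K i))) ∂(factorialMeasure p ξ) ∂P := hpalm l hl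
    _ = ∫⁻ ξ, ∫⁻ L, G L (sub ξ (δ L)) ∂(ξ : Measure (Particle d)) ∂P := by
        refine lintegral_congr_ae ?_
        filter_upwards [hs] with ξ hξ
        exact hξ.lintegral_factorialMeasure_sub hF
    _ = lam * ∫⁻ ξ, ∫⁻ L, G L ξ * κ L ξ ∂μ ∂P := hP.gnz G hG
    _ = lam * ∫⁻ ξ, ∫⁻ K, r K (sub ξ (∑ i, δ (K i))) ∂(factorialMeasure p ξ) ∂P := by
        congr 1
        refine lintegral_congr_ae ?_
        filter_upwards [hs] with ξ hξ
        have : SFinite (factorialMeasure p ξ) := inferInstanceAs (SFinite (factorialKernel d p ξ))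
        have hm : Measurable fun q : Particle d × (Fin p → Particle d) =>
            F q.2 q.1 (sub ξ (∑ i, δ (q.2 i))) * κ q.1 ξ := by
          have h1 : Measurable fun q : Particle d × (Fin p → Particle d) =>
              (q.2, q.1, sub ξ (∑ i, δ (q.2 i))) :=
            measurable_snd.prodMk (measurable_fst.prodMk
              (measurable_config_sub_sum_δ measurable_const measurable_snd))
          have h2 : Measurable fun q : Particle d × (Fin p → Particle d) => (q.1, ξ) :=
            measurable_fst.prodMk measurable_const
          exact (hF.comp h1).mul (measurable_coe_nnreal_ennreal.comp (hκ.comp h2))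
        calc ∫⁻ L, G L ξ * κ L ξ ∂μ
            = ∫⁻ L, ∫⁻ K, F K L (sub ξ (∑ i, δ (K i))) * κ L ξ ∂(factorialMeasure p ξ) ∂μ :=
              lintegral_congr fun L =>
                (lintegral_mul_const _ ((hF' L).comp measurable_prodMk_right)).symm
          _ = ∫⁻ K, ∫⁻ L, F K L (sub ξ (∑ i, δ (K i))) * κ L ξ ∂μ ∂(factorialMeasure p ξ) :=
              lintegral_lintegral_swap hm.aemeasurable
          _ = _ := by
              refine lintegral_congr_ae ?_
              filter_upwards [ae_factorialMeasure (p := p) ξ] with K ⟨hK, hatom⟩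
              have hadd : sub ξ (∑ i, δ (K i)) + ∑ i, δ (K i) = ξ := by
                rw [hξ.sub_sum_δ hK hatom, ← hξ.eq_add_sum_δ hK hatom]
              simp only [r, hadd]
    _ = _ := by rw [← hpalm r hr]

/-! ### Gibbs distributions with boundary conditions -/

/-- The conditional distribution of `ξ_Ψ` given `ξ_{Ψᶜ} = χ` under a Gibbs distribution is Gibbs
with boundary condition `χ`: for `L ∈ Ψ`, removing `L` from `ξ` removes it from `ξ_Ψ` and leaves
`ξ_{Ψᶜ}` unchanged. -/
theorem IsGibbs.ae_condKernel {μ : Measure (Particle d)} [SFinite μ] {lam : ℝ≥0}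
    {κ : Particle d → Config d → ℝ≥0} {P : Measure (Config d)} (hP : IsGibbs μ lam κ P)
    (hs : ∀ᵐ ξ ∂P, HasNoMultiplePoints ξ) {Ψ : Set (Particle d)} (hΨ : MeasurableSet Ψ)
    {Q : Kernel (Config d) (Config d)} [IsMarkovKernel Q]
    (hQ : (P.map fun ξ => (restrict ξ Ψᶜ, restrict ξ Ψ)).IsCondKernel Q) :
    ∀ᵐ χ ∂(P.map fun ξ => restrict ξ Ψᶜ),
      IsGibbs μ lam (fun L ξ => Ψ.indicator (fun L => κ L (ξ + χ)) L) (Q χ) ∧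
        ∀ᵐ ξ ∂(Q χ), HasNoMultiplePoints ξ := by
  have := hP.isProbabilityMeasure
  have hκ : Measurable (Function.uncurry κ) := hP.measurable_papangelou
  have hin : Measurable fun ξ : Config d => restrict ξ Ψ := measurable_restrict hΨ
  have hout : Measurable fun ξ : Config d => restrict ξ Ψᶜ := measurable_restrict hΨ.compl
  have hpair : Measurable fun ξ : Config d => (restrict ξ Ψᶜ, restrict ξ Ψ) := hout.prodMk hin
  have : IsProbabilityMeasure (P.map fun ξ : Config d => restrict ξ Ψᶜ) :=
    Measure.isProbabilityMeasure_map hout.aemeasurable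
  have hdis : (P.map fun ξ => restrict ξ Ψᶜ) ⊗ₘ Q =
      P.map fun ξ => (restrict ξ Ψᶜ, restrict ξ Ψ) := by
    have h := hQ.disintegrate
    rwa [Measure.fst_map_prodMk hin] at h
  have hint : ∀ g : Config d → Config d → ℝ≥0∞, Measurable (Function.uncurry g) →
      ∫⁻ χ, ∫⁻ ξ, g χ ξ ∂(Q χ) ∂(P.map fun ξ => restrict ξ Ψᶜ) =
        ∫⁻ ξ, g (restrict ξ Ψᶜ) (restrict ξ Ψ) ∂P := by
    intro g hg
    have h := Measure.lintegral_compProd (μ := P.map fun ξ => restrict ξ Ψᶜ) (κ := Q) hg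
    rw [hdis, lintegral_map hg hpair] at h
    exact h.symm
  refine Filter.Eventually.and ?_ ?_
  swap
  · refine Measure.ae_ae_of_ae_compProd
      (p := fun q : Config d × Config d => HasNoMultiplePoints q.2) ?_
    have hm : MeasurableSet {q : Config d × Config d | HasNoMultiplePoints q.2} :=
      measurable_snd measurableSet_hasNoMultiplePoints
    rw [hdis, ae_map_iff hpair.aemeasurable hm]
    filter_upwards [hs] with ξ hξ using hξ.restrict Ψ
  have hκ' : Measurable fun q : Config d × Particle d × Config d =>
      Ψ.indicator (fun L => κ L (q.2.2 + q.1)) q.2.1 := by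
    have h1 : Measurable fun q : Config d × Particle d × Config d => (q.2.1, q.2.2 + q.1) :=
      (measurable_fst.comp measurable_snd).prodMk
        ((measurable_snd.comp measurable_snd).add measurable_fst)
    exact (hκ.comp h1).indicator ((measurable_fst.comp measurable_snd) hΨ)
  refine ae_isGibbs_of_lintegral Q hκ' fun F hF => ?_
  let l : Config d → Config d → ℝ≥0∞ := fun χ ξ =>
    ∫⁻ L, F χ L (sub ξ (δ L)) ∂(ξ : Measure (Particle d))
  let r : Config d → Config d → ℝ≥0∞ := fun χ ξ =>
    ∫⁻ L, F χ L ξ * (Ψ.indicator (fun L => κ L (ξ + χ)) L : ℝ≥0) ∂μ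
  have hl : Measurable (Function.uncurry l) := by
    have h1 : Measurable fun q : (Config d × Config d) × Particle d =>
        (q.1.1, q.2, sub q.1.2 (δ q.2)) :=
      (measurable_fst.comp measurable_fst).prodMk (measurable_snd.prodMk
        (measurable_config_sub_δ (measurable_snd.comp measurable_fst) measurable_snd))
    exact Measurable.lintegral_kernel_prod_right'
      (κ := (configKernel d).comap Prod.snd (measurable_snd (α := Config d))) (hF.comp h1)
  have hr : Measurable (Function.uncurry r) := by
    have h1 : Measurable fun q : (Config d × Config d) × Particle d =>
        (q.1.1, q.2, q.1.2) := by fun_prop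
    exact Measurable.lintegral_prod_right' (ν := μ)
      ((hF.comp h1).mul (measurable_coe_nnreal_ennreal.comp (hκ'.comp h1)))
  let G : Particle d → Config d → ℝ≥0∞ := fun L η =>
    Ψ.indicator (fun L => F (restrict η Ψᶜ) L (restrict η Ψ)) L
  have hG : Measurable (Function.uncurry G) := by
    have h1 : Measurable fun q : Particle d × Config d =>
        (restrict q.2 Ψᶜ, q.1, restrict q.2 Ψ) :=
      (hout.comp measurable_snd).prodMk (measurable_fst.prodMk (hin.comp measurable_snd))
    exact (hF.comp h1).indicator (measurable_fst hΨ)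
  rw [lintegral_const_mul _ (Measurable.lintegral_kernel_prod_right hr)]
  calc ∫⁻ χ, ∫⁻ ξ, l χ ξ ∂(Q χ) ∂(P.map fun ξ => restrict ξ Ψᶜ)
      = ∫⁻ ξ, l (restrict ξ Ψᶜ) (restrict ξ Ψ) ∂P := hint l hl
    _ = ∫⁻ ξ, ∫⁻ L, G L (sub ξ (δ L)) ∂(ξ : Measure (Particle d)) ∂P := by
        refine lintegral_congr_ae ?_
        filter_upwards [hs] with ξ hξ
        change ∫⁻ L in Ψ, F (restrict ξ Ψᶜ) L (sub (restrict ξ Ψ) (δ L))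
          ∂(ξ : Measure (Particle d)) = _
        rw [← lintegral_indicator hΨ]
        refine lintegral_congr_ae ?_
        filter_upwards [ae_singleton_ne_zero ξ] with L hL
        by_cases hLΨ : L ∈ Ψ
        · have hL' : (restrict ξ Ψ : Measure (Particle d)) {L} ≠ 0 := by
            rw [restrict, Measure.restrict_apply (measurableSet_singleton L),
              Set.inter_eq_left.2 (by simpa using hLΨ)]
            exact hL
          have h1 : restrict (restrict ξ {L}ᶜ) Ψᶜ = restrict ξ Ψᶜ := by
            refine Subtype.ext ?_
            simp only [restrict]
            rw [Measure.restrict_restrict hΨ.compl, Set.inter_eq_left.2]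
            rintro K hK rfl
            exact hK hLΨ
          have h2 : restrict (restrict ξ {L}ᶜ) Ψ = restrict (restrict ξ Ψ) {L}ᶜ := by
            refine Subtype.ext ?_
            simp only [restrict]
            rw [Measure.restrict_restrict hΨ,
              Measure.restrict_restrict (measurableSet_singleton L).compl, Set.inter_comm]
          simp only [G, Set.indicator_of_mem hLΨ]
          rw [(hξ.restrict Ψ).sub_δ hL', hξ.sub_δ hL, h1, h2]
        · simp only [G, Set.indicator_of_notMem hLΨ]
    _ = lam * ∫⁻ ξ, ∫⁻ L, G L ξ * κ L ξ ∂μ ∂P := hP.gnz G hG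
    _ = lam * ∫⁻ ξ, r (restrict ξ Ψᶜ) (restrict ξ Ψ) ∂P := by
        congr 1
        refine lintegral_congr fun ξ => lintegral_congr fun L => ?_
        have hadd : restrict ξ Ψ + restrict ξ Ψᶜ = ξ := by
          rw [add_comm, restrict_compl_add_restrict ξ hΨ]
        by_cases hLΨ : L ∈ Ψ
        · simp only [G, Set.indicator_of_mem hLΨ, hadd]
        · simp [G, Set.indicator_of_notMem hLΨ]
    _ = _ := by rw [← hint r hr]

theorem palmPapangelou_eq (κ : Particle d → Config d → ℝ≥0) (Ψ : Set (Particle d)) (χ : Config d)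
    (K : Fin p → Particle d) :
    palmPapangelou κ Ψ χ K =
      fun L ξ => Ψ.indicator (fun L => κ L (ξ + ∑ i, δ (K i) + χ)) L := by
  funext L ξ
  simp only [palmPapangelou, add_right_comm ξ]

instance (ν : Measure (Particle d)) [SFinite ν] : SFinite (particleMeasure ν) := by
  unfold particleMeasure
  infer_instance

end ParticleGibbs

theorem lemma2p3 (d : ℕ)
    (ν : Measure (ParticleGibbs.Particle d)) [IsProbabilityMeasure ν]
    (hcentred : ∀ᵐ K ∂ν, ParticleGibbs.center K = 0)
    (hbounded : ∃ R : ℝ, 0 < R ∧ ∀ᵐ K ∂ν,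
      (SetLike.coe K : Set (ParticleGibbs.Space d)) ⊆ closedBall 0 R)
    (lam : ℝ≥0) (hlam : 0 < lam)
    (κ : ParticleGibbs.Particle d → ParticleGibbs.Config d → ℝ≥0)
    {Ω : Type*} [MeasurableSpace Ω] (Pr : Measure Ω) [IsProbabilityMeasure Pr]
    (Ξ : Ω → ParticleGibbs.Config d) (hΞ : Measurable Ξ)
    (hsimple : ∀ᵐ ω ∂Pr, ParticleGibbs.IsSimple (Ξ ω))
    (hgibbs : ParticleGibbs.IsGibbs (ParticleGibbs.particleMeasure ν) lam κ (Pr.map Ξ))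
    (B : Set (ParticleGibbs.Space d)) (hB : MeasurableSet B) (hBb : Bornology.IsBounded B)
    (Ψ : Set (ParticleGibbs.Particle d)) (hΨ : Ψ = ParticleGibbs.center ⁻¹' B)
    (Q : Kernel (ParticleGibbs.Config d) (ParticleGibbs.Config d)) [IsMarkovKernel Q]
    (hQ : (Pr.map fun ω =>
      (ParticleGibbs.restrict (Ξ ω) Ψᶜ, ParticleGibbs.restrict (Ξ ω) Ψ)).IsCondKernel Q)
    (p : ℕ) :
    ∀ᵐ χ ∂(Pr.map fun ω => ParticleGibbs.restrict (Ξ ω) Ψᶜ),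
      ∀ R : Kernel (Fin p → ParticleGibbs.Particle d) (ParticleGibbs.Config d),
        ParticleGibbs.IsPalm p (Q χ) R →
        ∀ᵐ K ∂(ParticleGibbs.factorialMomentMeasure p (Q χ)),
          ParticleGibbs.IsGibbs (ParticleGibbs.particleMeasure ν) lam
            (ParticleGibbs.palmPapangelou κ Ψ χ K) (ParticleGibbs.reducedPalm R K) := by
  subst hΨ
  have hΨ : MeasurableSet (ParticleGibbs.center ⁻¹' B) :=
    ParticleGibbs.continuous_center.measurable hB
  have hout := ParticleGibbs.measurable_restrict hΨ.compl
  have hpair := hout.prodMk (ParticleGibbs.measurable_restrict hΨ)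
  have hs : ∀ᵐ ξ ∂(Pr.map Ξ), ParticleGibbs.HasNoMultiplePoints ξ := by
    rw [ae_map_iff hΞ.aemeasurable ParticleGibbs.measurableSet_hasNoMultiplePoints]
    filter_upwards [hsimple] with ω hω using hω.hasNoMultiplePoints
  have hQ' : ((Pr.map Ξ).map fun ξ =>
      (ParticleGibbs.restrict ξ (ParticleGibbs.center ⁻¹' B)ᶜ,
        ParticleGibbs.restrict ξ (ParticleGibbs.center ⁻¹' B))).IsCondKernel Q := by
    rwa [Measure.map_map hpair hΞ]
  have h := hgibbs.ae_condKernel hs hΨ hQ'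
  rw [Measure.map_map hout hΞ] at h
  filter_upwards [h] with χ ⟨hχ, hχs⟩ R hR
  filter_upwards [hχ.ae_reducedPalm hχs hR] with K hK
  rwa [ParticleGibbs.palmPapangelou_eq]
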